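/- Let $R$ be a ring with $1$ and $M$ a left $R$-module that is both Artinian and Noetherian. Let $N\subsetneq K\subsetneq L\subseteq M$ be submodules such that $E=L/N$ is indecomposable of composition length $2$, and put $A=L/K$, $B=K/N$. Conventions. A constituent of $M$ is a subquotient $P=U/V$ with $V\subseteq U\subseteq M$, recorded by the pair $(V,U)$. Virtual equality $\widehat{=}$ of constituents is the equivalence relation generated by $(U+V)/V\;\widehat{=}\;U/(U\cap V)$. The ordering $\lessdot$ ("is enclosed by") is the reflexive and transitive relation generated by $\widehat{=}$ and by $P\lessdot Q$ whenever $P$ is a subquotient of $Q$ not occurring as a direct summand, i.e. there is no decomposition $Q=D\oplus C$ in which the subquotient map carries $D$ isomorphically onto $P$. Let $\operatorname{rad}^0M=M$ and $\operatorname{rad}^{i+1}M=\operatorname{rad}(\operatorname{rad}^iM)$, and let $0=S_0(M)\subseteq S_1(M)\subseteq\cdots$ be the socle series. The constituent $E=L/N$ meets the $i$-th radical layer ($i\ge1$) if $N+(L\cap\operatorname{rad}^{i}M)\ne N+(L\cap\operatorname{rad}^{i-1}M)$, and it meets the $i$-th socle layer if $N+(L\cap S_i(M))\neq N+(L\cap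 S_{i-1}(M))$. The Loewy length of a module $Z$ is the least $n$ with $\operatorname{rad}^nZ=0$. A quotient $M/X$ is a maximal-depth $E$-enclosing quotient if $E\lessdot M/X$ and its Loewy length is the largest $i$ such that $E$ meets the $i$-th radical layer of $M$. A submodule $Y\subseteq M$ is a maximal-depth $E$-enclosing submodule if $E\lessdot Y$ and its Loewy length is the largest $i$ such that $E$ meets the $i$-th socle layer of $M$. (1) Let $\mathcal X$ be the set of submodules $X\subseteq M$ such that $M/X$ is a maximal-depth $E$-enclosing quotient of $M$, $L\cap X=N$ (so that $E\;\widehat{=}\;(L+X)/X$ is a submodule of $M/X$), and there are an injective hull $j\colon B\to I_B$ and an injective homomorphism $M/X\to I_B$ which restricts to $j$ on $B\;\widehat{=}\;(K+X)/X$ (so that $E\subseteq M/X\subseteq I_B$). Then $\mathcal X$ is non-empty; there is $X\in\mathcal X$ such that $M/X$ is $\lessdot$-maximal among the quotients $M/X'$ with $X'\in\mathcal X$ (that is, $M/X\lessdot M/X'$ implies $M/X\;\widehat{=}\;M/X'$); and $M/X$ is indecomposable for every $X\in\mathcal X$. (2) Assume that $A$ has a projective cover or that $R$ is left Artinian. Let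 $\mathcal Y$ be the set of submodules $Y\subseteq M$ such that $Y$ is a maximal-depth $E$-enclosing submodule of $M$, $Y+N=L$ (so that $E\;\widehat{=}\;Y/(Y\cap N)$ is a quotient of $Y$), and there are a projective cover $p\colon P_A\to A$ and a surjective homomorphism $P_A\to Y$ whose composite with $Y\to L/K=A$ is $p$ (so that $E$ is a quotient of $Y$ and $Y$ a quotient of $P_A$). Then $\mathcal Y$ is non-empty; there is $Y\in\mathcal Y$ that is $\lessdot$-maximal in $\mathcal Y$ (that is, $Y\lessdot Y'$ with $Y'\in\mathcal Y$ implies $Y\;\widehat{=}\;Y'$); and every $Y\in\mathcal Y$ is indecomposable. -/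

import Mathlib

namespace VirtualExt

universe u v w

section General

variable (R : Type u) [Ring R] (M : Type v) [AddCommGroup M] [Module R M]

/-- The radical powers `rad^i M`: `rad^0 M = M`, and `rad^(i+1) M` is the radical (intersection of
all maximal submodules) of the module `rad^i M`, regarded as a submodule of `M`. -/
noncomputable def radPow : ℕ → Submodule R M
  | 0 => ⊤
  | i + 1 => (Module.jacobson R ↥(radPow i)).map (radPow i).subtype

/-- The socle: the sum of all simple submodules. -/
def socle : Submodule R M :=
  sSup {S : Submodule R M | IsSimpleModule R ↥S}

/-- The socle series `S_i(M)`: `S_0(M) = 0`, and `S_(i+1)(M)` is the preimage in `M` of the socle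
of `M / S_i(M)`. -/
noncomputable def socPow : ℕ → Submodule R M
  | 0 => ⊥
  | i + 1 => (socle R (M ⧸ socPow i)).comap (socPow i).mkQ

/-- `M` has Loewy length `d`: `d` is the least natural number with `rad^d M = 0`. -/
def HasLoewyLength (d : ℕ) : Prop :=
  IsLeast {i : ℕ | radPow R M i = ⊥} d

/-- An indecomposable module: nonzero, without a nontrivial direct sum decomposition. -/
def Indecomposable : Prop :=
  Nontrivial M ∧ ∀ P Q : Submodule R M, IsCompl P Q → P = ⊥ ∨ Q = ⊥

variable {R M}

/-- `j : B → I` is an injective hull of `B`: `I` is an injective module and `j` is an injective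
map with essential image. -/
def IsInjectiveHull {B : Type v} [AddCommGroup B] [Module R B]
    {I : Type w} [AddCommGroup I] [Module R I] (j : B →ₗ[R] I) : Prop :=
  Module.Injective R I ∧ Function.Injective j ∧
    ∀ U : Submodule R I, U ⊓ LinearMap.range j = ⊥ → U = ⊥

/-- `p : P → A` is a projective cover of `A`: `P` is a projective module and `p` is a surjective
map with superfluous kernel. -/
def IsProjectiveCover {A : Type v} [AddCommGroup A] [Module R A]
    {P : Type w} [AddCommGroup P] [Module R P] (p : P →ₗ[R] A) : Prop :=
  Module.Projective R P ∧ Function.Surjective p ∧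
    ∀ U : Submodule R P, U ⊔ LinearMap.ker p = ⊤ → U = ⊤

/-- The module `A` has a projective cover. -/
def HasProjectiveCover (R : Type u) [Ring R] (A : Type v) [AddCommGroup A] [Module R A] : Prop :=
  ∃ (P : Type (max u v)) (_ : AddCommGroup P) (_ : Module R P) (p : P →ₗ[R] A),
    IsProjectiveCover p

end General

/-- A subquotient `upper / lower` of `M`, given by the two submodules themselves (not up to
isomorphism). A submodule of a subquotient of `M`, and a subquotient of a subquotient of `M`, is
again of this form, by the correspondence between submodules of `L / N` and submodules of `M`
between `N` and `L`. -/
structure Constituent (R : Type u) [Ring R] (M : Type v) [AddCommGroup M] [Module R M] where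
  lower : Submodule R M
  upper : Submodule R M
  le : lower ≤ upper

namespace Constituent

variable {R : Type u} [Ring R] {M : Type v} [AddCommGroup M] [Module R M]

/-- The subquotient `L / N`, for `N ≤ L`. -/
def of (N L : Submodule R M) (h : N ≤ L) : Constituent R M := ⟨N, L, h⟩

/-- The quotient `M / X` as a constituent of `M`. -/
def quot (X : Submodule R M) : Constituent R M := ⟨X, ⊤, le_top⟩

/-- The submodule `Y` as a constituent of `M`. -/
def sub (Y : Submodule R M) : Constituent R M := ⟨⊥, Y, bot_le⟩

/-- Equality in the virtual category: the equivalence relation generated by identifying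
`(A + B) / B` with `A / (A ∩ B)`. The other identifications that define the virtual category need
no separate clause for subquotients recorded as pairs of submodules of `M`:
`A / B` and `(A / C) / (B / C)` are the same pair, and so are `C` as a submodule of `B` and `C` as a
submodule of `A` for `C ⊆ B ⊆ A`; a submodule `V₀` of `V` with `V₀ ∩ W = 0` is identified with its
image `(V₀ + W) / W` in `V / W`, which is the case `A = V₀`, `B = W`; and the summands `M_i / S_i` of
`(⨁ M_i) / (⨁ S_i)` are identified with `(M_i + ⨁ S_k) / ⨁ S_k`, which is the case
`A = M_i`, `B = ⨁ S_k`. -/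
def VirtEq : Constituent R M → Constituent R M → Prop :=
  Relation.EqvGen fun P Q =>
    ∃ A B : Submodule R M, P = ⟨B, A ⊔ B, le_sup_right⟩ ∧ Q = ⟨A ⊓ B, A, inf_le_left⟩

/-- `P` is a subquotient of `Q`, but not as a direct summand: there is no direct sum decomposition
`Q = D ⊕ C` such that the subquotient map carries `D` isomorphically onto `P`. -/
def NonsplitIn (P Q : Constituent R M) : Prop :=
  Q.lower ≤ P.lower ∧ P.upper ≤ Q.upper ∧
    ¬ ∃ D C : Submodule R M, D ⊔ C = Q.upper ∧ D ⊓ C = Q.lower ∧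
      P.lower ⊔ D = P.upper ∧ P.lower ⊓ D = Q.lower

/-- The ordering `P ⋖ Q` ("`Q` encloses `P`") on virtual constituents: the reflexive and transitive
relation, compatible with equality in the virtual category, generated by being a non-split
(submodule of a) subquotient. -/
def Enclosed : Constituent R M → Constituent R M → Prop :=
  Relation.ReflTransGen fun P Q => VirtEq P Q ∨ NonsplitIn P Q

/-- The part of `E = L / N` on the `(i+1)`-st radical layer `rad^i M / rad^(i+1) M` of `M`, that is
`(N + L ∩ rad^i M) / (N + L ∩ rad^(i+1) M)`, is nonzero. -/
def MeetsRadLayer (E : Constituent R M) (i : ℕ) : Prop :=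
  E.lower ⊔ (E.upper ⊓ radPow R M (i + 1)) ≠ E.lower ⊔ (E.upper ⊓ radPow R M i)

/-- The part of `E = L / N` on the `(i+1)`-st socle layer `S_(i+1)(M) / S_i(M)` of `M`, that is
`(N + L ∩ S_(i+1)(M)) / (N + L ∩ S_i(M))`, is nonzero. -/
def MeetsSocLayer (E : Constituent R M) (i : ℕ) : Prop :=
  E.lower ⊔ (E.upper ⊓ socPow R M (i + 1)) ≠ E.lower ⊔ (E.upper ⊓ socPow R M i)

/-- The lowest simple constituents of `E` in the radical series of `M` lie on the `d`-th layer
`rad^(d-1) M / rad^d M`. -/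
def RadDepth (E : Constituent R M) (d : ℕ) : Prop :=
  IsGreatest {k : ℕ | ∃ i : ℕ, k = i + 1 ∧ E.MeetsRadLayer i} d

/-- The highest simple constituents of `E` in the socle series of `M` lie on the `d`-th layer
`S_d(M) / S_(d-1)(M)`. -/
def SocDepth (E : Constituent R M) (d : ℕ) : Prop :=
  IsGreatest {k : ℕ | ∃ i : ℕ, k = i + 1 ∧ E.MeetsSocLayer i} d

/-- `M / X` is a maximal-depth `E`-enclosing quotient of `M`: it encloses `E`, and its Loewy length
is the number of the lowest radical layer of `M` on which `E` has constituents. -/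
def MaxDepthEnclosingQuotient (E : Constituent R M) (X : Submodule R M) : Prop :=
  Enclosed E (quot X) ∧ ∃ d : ℕ, E.RadDepth d ∧ HasLoewyLength R (M ⧸ X) d

/-- `Y` is a maximal-depth `E`-enclosing submodule of `M`: it encloses `E`, and its Loewy length is
the number of the highest socle layer of `M` on which `E` has constituents. -/
def MaxDepthEnclosingSubmodule (E : Constituent R M) (Y : Submodule R M) : Prop :=
  Enclosed E (sub Y) ∧ ∃ d : ℕ, E.SocDepth d ∧ HasLoewyLength R ↥Y d

end Constituent

open Constituent

variable {R : Type u} [Ring R] {M : Type v} [AddCommGroup M] [Module R M]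

/-- For `N ≤ K ≤ L`: `M / X` is a maximal-depth `E`-enclosing quotient of `M`, for `E = L / N`, that
has `E` as the submodule `(L + X) / X ≙ L / (L ∩ X) = L / N`, and there is an injective hull
`j : B → I` of `B = K / N` over `M / X`: `M / X` embeds in `I` by a map that restricts to `j`
on `B`. So `E ⊆ M / X ⊆ I`. -/
def IsHullQuotient (N K L : Submodule R M) (hNL : N ≤ L) (X : Submodule R M) : Prop :=
  MaxDepthEnclosingQuotient (Constituent.of N L hNL) X ∧
  L ⊓ X = N ∧
  ∃ (I : Type (max u v)) (_ : AddCommGroup I) (_ : Module R I)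
    (j : (↥K ⧸ N.submoduleOf K) →ₗ[R] I) (f : (M ⧸ X) →ₗ[R] I),
    IsInjectiveHull j ∧ Function.Injective f ∧
      ∀ k : ↥K, f (X.mkQ (k : M)) = j ((N.submoduleOf K).mkQ k)

/-- For `N ≤ K ≤ L`: `Y` is a maximal-depth `E`-enclosing submodule of `M`, for `E = L / N`, that
has `E` as the quotient `Y / (Y ∩ N) ≙ (Y + N) / N = L / N`, and there is a projective cover
`p : P → A` of `A = L / K` over `Y`: `P` maps onto `Y` by a map that induces `p` on `A`.
So `P ↠ Y ↠ E`. -/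
def IsCoverSubmodule (N K L : Submodule R M) (hNL : N ≤ L) (Y : Submodule R M) : Prop :=
  MaxDepthEnclosingSubmodule (Constituent.of N L hNL) Y ∧
  Y ⊔ N = L ∧
  ∃ (P : Type (max u v)) (_ : AddCommGroup P) (_ : Module R P)
    (p : P →ₗ[R] (↥L ⧸ K.submoduleOf L)) (g : P →ₗ[R] ↥Y) (hYL : Y ≤ L),
    IsProjectiveCover p ∧ Function.Surjective g ∧
      ∀ x : P, (K.submoduleOf L).mkQ (Submodule.inclusion hYL (g x)) = p x

end VirtualExt

/-!
An indecomposable module of length two is both uniform and hollow; only this is used about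
`E = L / N`.

Since `E` has no constituent on the radical layers of `M` after the `d`-th, `L` meets
`N + rad^d M` in `N`, so the injective hull `B → I_B` extends to a map `M → I_B` that kills
`N + rad^d M`. Let `X` be its kernel. As `B` is essential in the uniform module `E`, the induced map
`E → I_B` is injective, so `L ∩ X = N`, and the Loewy length of `M / X` is exactly `d`. Every module
between `B` and `I_B` is uniform, hence indecomposable, hence contains `E` as a direct summand only
if it equals `E`. Dually, if `e` is the last socle layer of `M` that `E` meets, the projective cover
of `A` lifts to `L ∩ S_e(M)`, and its image `Y` is hollow and maps onto `E`.

Proper enclosure strictly increases the composition length, so maximal elements exist.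
-/

namespace VirtualExt

universe u v w

open Submodule

section UniformHollow

variable {R : Type u} [Ring R] {M : Type v} [AddCommGroup M] [Module R M]
  {M' : Type w} [AddCommGroup M'] [Module R M']

/-- A uniform module: nonzero, and any two nonzero submodules have a nonzero intersection. -/
def IsUniform (R : Type u) [Ring R] (M : Type v) [AddCommGroup M] [Module R M] : Prop :=
  Nontrivial M ∧ ∀ P Q : Submodule R M, P ⊓ Q = ⊥ → P = ⊥ ∨ Q = ⊥

/-- A hollow module, the notion dual to `IsUniform`: nonzero, and not the sum of two proper
submodules. -/
def IsHollow (R : Type u) [Ring R] (M : Type v) [AddCommGroup M] [Module R M] : Prop :=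
  Nontrivial M ∧ ∀ P Q : Submodule R M, P ⊔ Q = ⊤ → P = ⊤ ∨ Q = ⊤

/-- An essential submodule: only the zero submodule meets it trivially. -/
def IsEssential (S : Submodule R M) : Prop :=
  ∀ U : Submodule R M, U ⊓ S = ⊥ → U = ⊥

/-- A superfluous submodule, the notion dual to `IsEssential`: only the whole module is
a supplement of it. -/
def IsSuperfluous (S : Submodule R M) : Prop :=
  ∀ U : Submodule R M, U ⊔ S = ⊤ → U = ⊤

theorem IsUniform.indecomposable (h : IsUniform R M) : Indecomposable R M :=
  ⟨h.1, fun P Q hPQ => h.2 P Q hPQ.inf_eq_bot⟩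

theorem IsHollow.indecomposable (h : IsHollow R M) : Indecomposable R M := by
  refine ⟨h.1, fun P Q hPQ => ?_⟩
  rcases h.2 P Q hPQ.sup_eq_top with rfl | rfl
  · exact .inr (eq_bot_of_top_isCompl hPQ)
  · exact .inl (eq_bot_of_isCompl_top hPQ)

theorem IsUniform.isEssential (h : IsUniform R M) {S : Submodule R M} (hS : S ≠ ⊥) :
    IsEssential S :=
  fun U hU => (h.2 U S hU).resolve_right hS

theorem IsHollow.isSuperfluous (h : IsHollow R M) {S : Submodule R M} (hS : S ≠ ⊤) :
    IsSuperfluous S :=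
  fun U hU => (h.2 U S hU).resolve_right hS

theorem IsUniform.of_injective [Nontrivial M] (h : IsUniform R M') (f : M →ₗ[R] M')
    (hf : Function.Injective f) : IsUniform R M := by
  have hbot {P : Submodule R M} (hP : P.map f = ⊥) : P = ⊥ :=
    map_injective_of_injective hf (hP.trans (Submodule.map_bot f).symm)
  refine ⟨‹_›, fun P Q hPQ => ?_⟩
  have hmap : P.map f ⊓ Q.map f = ⊥ := by rw [← map_inf f hf, hPQ, Submodule.map_bot]
  exact (h.2 _ _ hmap).imp hbot hbot

theorem IsHollow.of_surjective [Nontrivial M'] (h : IsHollow R M) (f : M →ₗ[R] M')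
    (hf : Function.Surjective f) : IsHollow R M' := by
  have htop {P : Submodule R M'} (hP : P.comap f = ⊤) : P = ⊤ :=
    comap_injective_of_surjective hf (hP.trans (comap_top f).symm)
  refine ⟨‹_›, fun P Q hPQ => (h.2 (P.comap f) (Q.comap f) ?_).imp htop htop⟩
  have hker : LinearMap.ker f ≤ P.comap f ⊔ Q.comap f :=
    (LinearMap.ker_le_comap f).trans le_sup_left
  rw [← comap_map_eq_self hker, Submodule.map_sup, map_comap_eq_of_surjective hf,
    map_comap_eq_of_surjective hf, hPQ, comap_top]

theorem IsEssential.isUniform {f : M →ₗ[R] M'} (hf : IsEssential (LinearMap.range f))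
    (hinj : Function.Injective f) (h : IsUniform R M) : IsUniform R M' := by
  have := h.1
  have hbot {P : Submodule R M'} (hP : P.comap f = ⊥) : P = ⊥ :=
    hf P (by rw [inf_comm, ← map_comap_eq, hP, Submodule.map_bot])
  refine ⟨hinj.nontrivial, fun P Q hPQ => (h.2 (P.comap f) (Q.comap f) ?_).imp hbot hbot⟩
  rw [← comap_inf, hPQ, comap_bot, LinearMap.ker_eq_bot.2 hinj]

theorem IsSuperfluous.isHollow {f : M →ₗ[R] M'} (hf : IsSuperfluous (LinearMap.ker f))
    (hsurj : Function.Surjective f) (h : IsHollow R M') : IsHollow R M := by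
  have := h.1
  have htop {P : Submodule R M} (hP : P.map f = ⊤) : P = ⊤ :=
    hf P (by rw [← comap_map_eq, hP, comap_top])
  refine ⟨hsurj.nontrivial, fun P Q hPQ => (h.2 (P.map f) (Q.map f) ?_).imp htop htop⟩
  rw [← Submodule.map_sup, hPQ, Submodule.map_top, LinearMap.range_eq_top.2 hsurj]

theorem IsEssential.injective_of_comp {B : Type*} [AddCommGroup B] [Module R B] {i : B →ₗ[R] M}
    (hi : IsEssential (LinearMap.range i)) {f : M →ₗ[R] M'}
    (hfi : Function.Injective (f ∘ₗ i)) : Function.Injective f := by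
  refine LinearMap.ker_eq_bot.1 (hi _ ?_)
  rw [inf_comm, ← map_comap_eq, ← LinearMap.ker_comp, LinearMap.ker_eq_bot.2 hfi, Submodule.map_bot]

theorem IsSuperfluous.surjective_of_comp {A : Type*} [AddCommGroup A] [Module R A]
    {q : M' →ₗ[R] A} (hq : IsSuperfluous (LinearMap.ker q)) {f : M →ₗ[R] M'}
    (hqf : Function.Surjective (q ∘ₗ f)) : Function.Surjective f := by
  refine LinearMap.range_eq_top.1 (hq _ ?_)
  rw [← comap_map_eq, ← LinearMap.range_comp, LinearMap.range_eq_top.2 hqf, comap_top]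

end UniformHollow

section LengthTwo

variable {R : Type u} [Ring R] {M : Type v} [AddCommGroup M] [Module R M]

theorem eq_top_of_length_eq_two (hM : Module.length R M = 2) {U W : Submodule R M} (hU : U ≠ ⊥)
    (hUW : U < W) : W = ⊤ := by
  have hfin : Module.length R M ≠ ⊤ := hM ▸ ENat.natCast_ne_top 2
  obtain ⟨_, _⟩ := isFiniteLength_iff_isNoetherian_isArtinian.1 (Module.length_ne_top_iff.1 hfin)
  by_contra hW
  have hW2 := Submodule.height_strictMono (Ne.lt_top hW)
  rw [← Module.length_eq_height, hM] at hW2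
  have hW1 : Order.height W ≤ 1 := Order.le_of_lt_add_one hW2
  have hU0 : Order.height U = 0 := Order.lt_one_iff.1 ((height_strictMono hUW).trans_le hW1)
  exact hU (Order.height_eq_zero.1 hU0).eq_bot

theorem Indecomposable.isUniform_of_length_eq_two (h : Indecomposable R M)
    (hM : Module.length R M = 2) : IsUniform R M := by
  refine ⟨h.1, fun P Q hPQ => ?_⟩
  by_contra! hne
  have hlt : P < P ⊔ Q := left_lt_sup.2 fun hQP => hne.2 (by rwa [inf_eq_right.2 hQP] at hPQ)
  exact (h.2 P Q (.of_eq hPQ (eq_top_of_length_eq_two hM hne.1 hlt))).elim hne.1 hne.2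

theorem Indecomposable.isHollow_of_length_eq_two (h : Indecomposable R M)
    (hM : Module.length R M = 2) : IsHollow R M := by
  refine ⟨h.1, fun P Q hPQ => ?_⟩
  by_contra! hne
  have hlt : P ⊓ Q < P := inf_lt_left.2 fun hle => hne.2 (by rwa [sup_eq_right.2 hle] at hPQ)
  have hinf : P ⊓ Q = ⊥ := by_contra fun h0 => hne.1 (eq_top_of_length_eq_two hM h0 hlt)
  rcases h.2 P Q (.of_eq hinf hPQ) with rfl | rfl
  · exact hne.2 (by rwa [bot_sup_eq] at hPQ)
  · exact hne.1 (by rwa [sup_bot_eq] at hPQ)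

end LengthTwo

section RadicalSocle

variable {R : Type u} [Ring R] {M : Type v} [AddCommGroup M] [Module R M]
  {M' : Type w} [AddCommGroup M'] [Module R M']

theorem map_jacobson_of_surjective [IsArtinian R M] (f : M →ₗ[R] M')
    (hf : Function.Surjective f) : (Module.jacobson R M).map f = Module.jacobson R M' := by
  refine le_antisymm (Module.map_jacobson_le f) (Module.jacobson_le_of_eq_bot ?_)
  have : IsSemisimpleModule R (M ⧸ Module.jacobson R M) :=
    (IsArtinian.isSemisimpleModule_iff_jacobson R _).2 (Module.jacobson_quotient_jacobson R M)
  let g := mapQ (Module.jacobson R M) ((Module.jacobson R M).map f) f (le_comap_map f _)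
  have hg : Function.Surjective g :=
    .of_comp (g := (mkQ _ : M →ₗ[R] _)) ((mkQ_surjective _).comp hf)
  have := IsSemisimpleModule.of_surjective g hg
  exact IsSemisimpleModule.jacobson_eq_bot R _

theorem map_radPow_of_surjective [IsArtinian R M] (f : M →ₗ[R] M')
    (hf : Function.Surjective f) (i : ℕ) : (radPow R M i).map f = radPow R M' i := by
  induction i with
  | zero => simpa [radPow] using LinearMap.range_eq_top.2 hf
  | succ i ih =>
    rw [radPow, radPow, ← ih, ← map_jacobson_of_surjective _ (f.submoduleMap_surjective _),
      ← map_comp, ← map_comp]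
    rfl

theorem radPow_antitone : Antitone (radPow R M) :=
  antitone_nat_of_succ_le fun _ => map_subtype_le _ _

theorem radPow_succ_ne [IsNoetherian R M] {i : ℕ} (hi : radPow R M i ≠ ⊥) :
    radPow R M (i + 1) ≠ radPow R M i := by
  have := nontrivial_iff_ne_bot.2 hi
  intro he
  refine (Module.jacobson_lt_top R (radPow R M i)).ne ?_
  exact map_injective_of_injective (subtype_injective _) (he.trans (map_subtype_top _).symm)

theorem exists_radPow_eq_bot [IsArtinian R M] [IsNoetherian R M] : ∃ n, radPow R M n = ⊥ := by
  obtain ⟨n, hn⟩ := IsArtinian.monotone_stabilizes (R := R) (M := M)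
    ⟨OrderDual.toDual ∘ radPow R M, radPow_antitone⟩
  exact ⟨n, by_contra fun h => radPow_succ_ne h (hn (n + 1) n.le_succ).symm⟩

theorem isSemisimpleModule_socle : IsSemisimpleModule R (socle R M) := by
  rw [socle, sSup_eq_iSup]
  exact isSemisimpleModule_biSup_of_isSemisimpleModule_submodule fun S (hS : IsSimpleModule R S) =>
    inferInstance

theorem le_socle_iff {W : Submodule R M} : W ≤ socle R M ↔ IsSemisimpleModule R W := by
  refine ⟨fun h => ?_, fun _ => ?_⟩
  · have := isSemisimpleModule_socle (R := R) (M := M)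
    exact .of_injective (inclusion h) (inclusion_injective h)
  · rw [← map_subtype_top W, ← IsSemisimpleModule.sSup_simples_eq_top R W, map_le_iff_le_comap]
    refine sSup_le fun S (hS : IsSimpleModule R S) => map_le_iff_le_comap.1 (le_sSup ?_)
    exact IsSimpleModule.congr (S.equivMapOfInjective W.subtype W.subtype_injective).symm

theorem range_le_socle_iff [IsArtinian R M] (f : M →ₗ[R] M') :
    LinearMap.range f ≤ socle R M' ↔ Module.jacobson R M ≤ LinearMap.ker f := by
  rw [le_socle_iff, IsArtinian.isSemisimpleModule_iff_jacobson,
    ← map_jacobson_of_surjective f.rangeRestrict f.surjective_rangeRestrict,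
    ← LinearMap.le_ker_iff_map, LinearMap.ker_rangeRestrict]

theorem socPow_monotone : Monotone (socPow R M) :=
  monotone_nat_of_le_succ fun _ => le_comap_mkQ _ _

theorem map_radPow_succ_le_socPow_iff [IsArtinian R M'] (f : M' →ₗ[R] M) (i j : ℕ) :
    (radPow R M' (i + 1)).map f ≤ socPow R M j ↔
      (radPow R M' i).map f ≤ socPow R M (j + 1) := by
  have key := range_le_socle_iff ((socPow R M j).mkQ ∘ₗ f ∘ₗ (radPow R M' i).subtype)
  rw [LinearMap.ker_comp, ker_mkQ, comap_comp] at key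
  rw [radPow, socPow, map_le_iff_le_comap, map_le_iff_le_comap, ← key, ← map_le_iff_le_comap,
    LinearMap.range_comp, LinearMap.range_comp, range_subtype]

theorem map_radPow_le_socPow_iff [IsArtinian R M'] (f : M' →ₗ[R] M) (i j : ℕ) :
    (radPow R M' i).map f ≤ socPow R M j ↔ LinearMap.range f ≤ socPow R M (i + j) := by
  induction i generalizing j with
  | zero => rw [radPow, Submodule.map_top, zero_add]
  | succ i ih => rw [map_radPow_succ_le_socPow_iff, ih, add_right_comm, add_assoc]

theorem radPow_quotient_eq_bot_iff [IsArtinian R M] (X : Submodule R M) (i : ℕ) :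
    radPow R (M ⧸ X) i = ⊥ ↔ radPow R M i ≤ X := by
  rw [← map_radPow_of_surjective X.mkQ X.mkQ_surjective, ← LinearMap.le_ker_iff_map, ker_mkQ]

theorem radPow_submodule_eq_bot_iff [IsArtinian R M] (Y : Submodule R M) (i : ℕ) :
    radPow R Y i = ⊥ ↔ Y ≤ socPow R M i := by
  have key := map_radPow_le_socPow_iff Y.subtype i 0
  rwa [socPow, le_bot_iff, ← LinearMap.le_ker_iff_map, ker_subtype, le_bot_iff,
    range_subtype] at key

theorem exists_socPow_eq_top [IsArtinian R M] [IsNoetherian R M] : ∃ n, socPow R M n = ⊤ := by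
  obtain ⟨n, hn⟩ := exists_radPow_eq_bot (R := R) (M := M)
  have key := map_radPow_le_socPow_iff (LinearMap.id : M →ₗ[R] M) n 0
  rw [hn, Submodule.map_bot, LinearMap.range_id, add_zero, top_le_iff] at key
  exact ⟨n, key.1 bot_le⟩

theorem hasLoewyLength_succ {n : ℕ} (h : radPow R M (n + 1) = ⊥) (h' : radPow R M n ≠ ⊥) :
    HasLoewyLength R M (n + 1) := by
  refine ⟨h, fun m (hm : radPow R M m = ⊥) => ?_⟩
  by_contra! hlt
  exact h' (eq_bot_mono (radPow_antitone (Nat.lt_succ_iff.1 hlt)) hm)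

end RadicalSocle

section InjectiveHull

variable {R : Type u} [Ring R]

theorem exists_le_maximal_disjoint {α : Type*} [CompleteLattice α] [IsCompactlyGenerated α]
    {a b : α} (hab : Disjoint a b) : ∃ c, a ≤ c ∧ Maximal (Disjoint · b) c :=
  zorn_le_nonempty₀ {c | Disjoint c b}
    (fun s hs hchain _ _ => ⟨sSup s, hchain.directedOn.disjoint_sSup_left.2 hs, fun _ => le_sSup⟩)
    a hab

theorem injective_of_comp_eq_id {J H : Type v} [AddCommGroup J] [Module R J]
    [Module.Injective R J] [AddCommGroup H] [Module R H] (i : H →ₗ[R] J) (r : J →ₗ[R] H)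
    (hri : r ∘ₗ i = LinearMap.id) : Module.Injective R H := by
  refine ⟨fun X Y _ _ _ _ f hf g => ?_⟩
  obtain ⟨k, hk⟩ := Module.Injective.out f hf (i ∘ₗ g)
  exact ⟨r ∘ₗ k, fun x => by simpa [hk] using LinearMap.congr_fun hri (g x)⟩

theorem isEssential_range_mkQ_comp_subtype {J : Type v} [AddCommGroup J] [Module R J]
    {C H : Submodule R J} (hC : Maximal (Disjoint · H) C) :
    IsEssential (LinearMap.range (C.mkQ ∘ₗ H.subtype)) := by
  intro V hV
  have hdisj : Disjoint (V.comap C.mkQ) H := by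
    refine disjoint_def.2 fun x hxV hxH => disjoint_def.1 hC.prop x ?_ hxH
    have hx : C.mkQ x ∈ V ⊓ LinearMap.range (C.mkQ ∘ₗ H.subtype) := ⟨hxV, ⟨x, hxH⟩, rfl⟩
    rwa [hV, mem_bot, ← LinearMap.mem_ker, ker_mkQ] at hx
  have hcomap : V.comap C.mkQ = C := hC.eq_of_ge hdisj (le_comap_mkQ C V)
  rw [← map_comap_eq_of_surjective C.mkQ_surjective V, hcomap, mkQ_map_self]

/-- By maximality of `C`, the quotient `J / C` embeds in `J` over `H`; by maximality of `H`, the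
image is `H`, which is therefore a retract of `J`. -/
theorem injective_of_maximal_disjoint {J : Type v} [AddCommGroup J] [Module R J]
    [Small.{v} R] [Module.Injective R J] {C H : Submodule R J} (hC : Maximal (Disjoint · H) C)
    (hH : Maximal (Disjoint · C) H) : Module.Injective R H := by
  let φ : H →ₗ[R] J ⧸ C := C.mkQ ∘ₗ H.subtype
  have hφ : Function.Injective φ := by
    rw [← LinearMap.ker_eq_bot, LinearMap.ker_comp, ker_mkQ]
    exact disjoint_iff_comap_eq_bot.1 hC.prop.symm
  have hess : IsEssential (LinearMap.range φ) := isEssential_range_mkQ_comp_subtype hC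
  obtain ⟨h, hh⟩ := Module.Injective.extension_property R J H (J ⧸ C) φ hφ H.subtype
  have hhφ (x : H) : h (φ x) = x := LinearMap.congr_fun hh x
  have hHh : H ≤ LinearMap.range h := fun x hx => ⟨φ ⟨x, hx⟩, hhφ ⟨x, hx⟩⟩
  have hcomap : C.comap h = ⊥ := by
    refine hess _ (eq_bot_iff.2 ?_)
    rintro _ ⟨hxC, x, rfl⟩
    have hx : (x : J) = 0 := disjoint_def.1 hC.prop x (hhφ x ▸ hxC) x.2
    rw [mem_bot, coe_eq_zero.1 hx, map_zero]
  have hdisj : Disjoint (LinearMap.range h) C := by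
    rw [disjoint_iff, ← map_comap_eq, hcomap, Submodule.map_bot]
  have hrange : LinearMap.range h = H := (hH.eq_of_le hdisj hHh).symm
  exact injective_of_comp_eq_id H.subtype
    ((h ∘ₗ C.mkQ).codRestrict H fun x => hrange.le ⟨_, rfl⟩)
    (LinearMap.ext fun x => Subtype.ext (hhφ x))

theorem eq_bot_of_disjoint_of_maximal {α : Type*} [Lattice α] [OrderBot α] [IsModularLattice α]
    {s u h c : α} (hc : Maximal (Disjoint · s) c) (hch : Disjoint c h) (hsh : s ≤ h) (huh : u ≤ h)
    (hus : Disjoint u s) : u = ⊥ := by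
  have hsuc : Disjoint (s ⊔ u) c := hch.symm.mono_left (sup_le hsh huh)
  have huc : u ⊔ c ≤ c :=
    hc.le_of_ge (hus.symm.disjoint_sup_right_of_disjoint_sup_left hsuc).symm le_sup_right
  exact (hch.mono_right huh).symm.eq_bot_of_le (le_sup_left.trans huc)

theorem exists_injective_isEssential_submoduleOf {J : Type v} [AddCommGroup J] [Module R J]
    [Small.{v} R] [Module.Injective R J] (S : Submodule R J) :
    ∃ H, S ≤ H ∧ Module.Injective R H ∧ IsEssential (S.submoduleOf H) := by
  obtain ⟨C, -, hC⟩ := exists_le_maximal_disjoint (disjoint_bot_left (a := S))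
  obtain ⟨H, hSH, hH⟩ := exists_le_maximal_disjoint hC.prop.symm
  have hC' : Maximal (Disjoint · H) C :=
    ⟨hH.prop.symm, fun D hD hCD => hC.le_of_ge (hD.mono_right hSH) hCD⟩
  refine ⟨H, hSH, injective_of_maximal_disjoint hC' hH, fun U hU => ?_⟩
  have hUS : Disjoint (U.map H.subtype) S := by
    rw [disjoint_iff, map_inf_eq_map_inf_comap]
    exact (congrArg _ hU).trans (Submodule.map_bot _)
  have hmap : U.map H.subtype = ⊥ :=
    eq_bot_of_disjoint_of_maximal hC hC'.prop hSH (map_subtype_le H U) hUS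
  exact map_injective_of_injective H.subtype_injective (hmap.trans (Submodule.map_bot _).symm)

theorem exists_injective_embedding (M : Type v) [AddCommGroup M] [Module R M] :
    ∃ (J : Type (max u v)) (_ : AddCommGroup J) (_ : Module R J) (f : M →ₗ[R] J),
      Module.Injective R J ∧ Function.Injective f := by
  have := ModuleCat.enoughInjectives.{v} R
  let X : ModuleCat.{max u v} R := ModuleCat.of R (ULift.{u} M)
  let J := CategoryTheory.Injective.under X
  have : CategoryTheory.Injective (ModuleCat.of R J) :=
    inferInstanceAs (CategoryTheory.Injective J)
  have hι := (ModuleCat.mono_iff_injective (CategoryTheory.Injective.ι X)).1 inferInstance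
  exact ⟨J, inferInstance, inferInstance,
    (CategoryTheory.Injective.ι X).hom ∘ₗ ULift.moduleEquiv.symm.toLinearMap,
    Module.injective_module_of_injective_object R J, hι.comp ULift.moduleEquiv.symm.injective⟩

theorem exists_isInjectiveHull (B : Type v) [AddCommGroup B] [Module R B] :
    ∃ (I : Type (max u v)) (_ : AddCommGroup I) (_ : Module R I) (j : B →ₗ[R] I),
      IsInjectiveHull j := by
  obtain ⟨J, _, _, f, _, hf⟩ := exists_injective_embedding (R := R) B
  obtain ⟨H, hfH, hH, hess⟩ := exists_injective_isEssential_submoduleOf (LinearMap.range f)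
  refine ⟨H, inferInstance, inferInstance, f.codRestrict H fun b => hfH ⟨b, rfl⟩, hH, ?_, ?_⟩
  · rwa [← LinearMap.ker_eq_bot, LinearMap.ker_codRestrict, LinearMap.ker_eq_bot]
  · rwa [LinearMap.range_codRestrict]

end InjectiveHull

section ProjectiveCover

variable {R : Type u} [Ring R]

theorem projective_of_isSuperfluous_ker {F : Type v} [AddCommGroup F] [Module R F]
    [Module.Projective R F] [IsNoetherian R F] {A : Type w} [AddCommGroup A] [Module R A]
    {f : F →ₗ[R] A} {U : Submodule R F} (hsurj : Function.Surjective (f ∘ₗ U.subtype))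
    (hker : IsSuperfluous (LinearMap.ker (f ∘ₗ U.subtype))) : Module.Projective R U := by
  obtain ⟨g, hg⟩ := Module.projective_lifting_property (f ∘ₗ U.subtype) f hsurj
  have hgU : Function.Surjective (g ∘ₗ U.subtype) :=
    hker.surjective_of_comp (by rwa [← LinearMap.comp_assoc, hg])
  let e := LinearEquiv.ofBijective (g ∘ₗ U.subtype)
    ⟨IsNoetherian.injective_of_surjective_endomorphism _ hgU, hgU⟩
  exact .of_split U.subtype (e.symm.toLinearMap ∘ₗ g) (LinearMap.ext e.symm_apply_apply)

theorem exists_surjective_isSuperfluous_ker {F : Type v} [AddCommGroup F] [Module R F]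
    [IsArtinian R F] {A : Type w} [AddCommGroup A] [Module R A] {f : F →ₗ[R] A}
    (hf : Function.Surjective f) : ∃ U : Submodule R F, Function.Surjective (f ∘ₗ U.subtype) ∧
      IsSuperfluous (LinearMap.ker (f ∘ₗ U.subtype)) := by
  obtain ⟨U, hU⟩ := exists_minimal_of_wellFoundedLT (fun U : Submodule R F => U.map f = ⊤)
    ⟨⊤, by rwa [Submodule.map_top, LinearMap.range_eq_top]⟩
  have hsurj : Function.Surjective (f ∘ₗ U.subtype) := by
    rw [← LinearMap.range_eq_top, LinearMap.range_comp, range_subtype, hU.prop]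
  refine ⟨U, hsurj, fun V hV => ?_⟩
  have hVf : (V.map U.subtype).map f = ⊤ := by
    rw [← map_comp, LinearMap.map_eq_top_iff (LinearMap.range_eq_top.2 hsurj), hV]
  have hVU : V.map U.subtype = U := hU.eq_of_le hVf (map_subtype_le _ _)
  exact map_injective_of_injective U.subtype_injective (hVU.trans (map_subtype_top U).symm)

theorem hasProjectiveCover_of_isArtinianRing [IsArtinianRing R] (A : Type v) [AddCommGroup A]
    [Module R A] [Module.Finite R A] : HasProjectiveCover R A := by
  obtain ⟨n, f, hf⟩ := Module.Finite.exists_fin' R A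
  let q : ULift.{v} (Fin n → R) ≃ₗ[R] (Fin n → R) := ULift.moduleEquiv
  have := isNoetherian_of_linearEquiv q.symm
  have := isArtinian_of_linearEquiv q.symm
  have hfq : Function.Surjective (f ∘ₗ q.toLinearMap) := hf.comp q.surjective
  obtain ⟨U, hsurj, hker⟩ := exists_surjective_isSuperfluous_ker hfq
  exact ⟨U, inferInstance, inferInstance, _,
    projective_of_isSuperfluous_ker hsurj hker, hsurj, hker⟩

end ProjectiveCover

section Depth

variable {R : Type u} [Ring R] {M : Type v} [AddCommGroup M] [Module R M]
  [IsArtinian R M] [IsNoetherian R M]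

theorem exists_isGreatest_jump {α : Type*} {F : ℕ → α} {b : α} (h0 : F 0 ≠ b) {n : ℕ}
    (hn : ∀ m ≥ n, F m = b) :
    ∃ i, IsGreatest {k : ℕ | ∃ i : ℕ, k = i + 1 ∧ F (i + 1) ≠ F i} (i + 1) ∧
      F (i + 1) = b ∧ F i ≠ b := by
  classical
  have hstable : ∃ k, ∀ m ≥ k, F m = b := ⟨n, hn⟩
  obtain ⟨i, hi⟩ : ∃ i, Nat.find hstable = i + 1 :=
    Nat.exists_eq_succ_of_ne_zero fun h => h0 (Nat.find_spec hstable 0 h.le)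
  have hge (m : ℕ) (hm : i + 1 ≤ m) : F m = b := Nat.find_spec hstable m (hi.le.trans hm)
  have hne : F i ≠ b := fun h => Nat.find_min hstable (hi.symm ▸ i.lt_succ_self) fun m hm =>
    hm.eq_or_lt.elim (fun hmi => hmi ▸ h) (hge m)
  refine ⟨i, ⟨⟨i, rfl, fun h => hne (h ▸ hge _ le_rfl)⟩, ?_⟩, hge _ le_rfl, hne⟩
  rintro _ ⟨j, rfl, hj⟩
  by_contra! hlt
  exact hj ((hge _ hlt.le).trans (hge _ (Nat.lt_succ_iff.1 hlt)).symm)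

theorem exists_radDepth {E : Constituent R M} (hE : E.lower < E.upper) :
    ∃ i, E.RadDepth (i + 1) ∧ E.upper ⊓ radPow R M (i + 1) ≤ E.lower ∧
      ¬ E.upper ⊓ radPow R M i ≤ E.lower := by
  obtain ⟨n, hn⟩ := exists_radPow_eq_bot (R := R) (M := M)
  simp only [← sup_eq_left]
  refine exists_isGreatest_jump (F := fun i => E.lower ⊔ (E.upper ⊓ radPow R M i)) (n := n) ?_
    fun m hm => ?_
  · simpa only [radPow, inf_top_eq, sup_eq_right.2 E.le] using hE.ne'
  · simp only [eq_bot_mono (radPow_antitone hm) hn, inf_bot_eq, sup_bot_eq]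

theorem exists_socDepth {E : Constituent R M} (hE : E.lower < E.upper) :
    ∃ i, E.SocDepth (i + 1) ∧ E.lower ⊔ (E.upper ⊓ socPow R M (i + 1)) = E.upper ∧
      E.lower ⊔ (E.upper ⊓ socPow R M i) ≠ E.upper := by
  obtain ⟨n, hn⟩ := exists_socPow_eq_top (R := R) (M := M)
  refine exists_isGreatest_jump (F := fun i => E.lower ⊔ (E.upper ⊓ socPow R M i)) (n := n) ?_
    fun m hm => ?_
  · simpa only [socPow, inf_bot_eq, sup_bot_eq] using hE.ne
  · simp only [eq_top_mono (socPow_monotone hm) hn, inf_top_eq, sup_eq_right.2 E.le]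

end Depth

section Length

variable {R : Type u} [Ring R] {M : Type v} [AddCommGroup M] [Module R M]

namespace Constituent

/-- The composition length of the subquotient `upper / lower`, with the junk value `0` if it is
infinite. -/
noncomputable def length (P : Constituent R M) : ℕ :=
  (Module.length R (P.upper ⧸ P.lower.submoduleOf P.upper)).toNat

theorem VirtEq.length_eq {P Q : Constituent R M} (h : VirtEq P Q) : P.length = Q.length := by
  induction h with
  | rel P Q h =>
    obtain ⟨A, B, rfl, rfl⟩ := h
    have e := (LinearMap.quotientInfEquivSupQuotient A B).length_eq
    rw [← comap_inf] at e
    exact congrArg ENat.toNat e.symm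
  | refl => rfl
  | symm _ _ _ ih => exact ih.symm
  | trans _ _ _ _ _ ih ih' => exact ih.trans ih'

variable [IsArtinian R M] [IsNoetherian R M]

theorem toNat_length_strictMono :
    StrictMono fun W : Submodule R M => (Module.length R W).toNat := by
  intro W W' h
  rw [← Nat.cast_lt (α := ℕ∞), ENat.natCast_toNat Module.length_ne_top,
    ENat.natCast_toNat Module.length_ne_top]
  simpa only [Module.length_submodule] using Submodule.height_strictMono h

theorem toNat_length_lower_add_length (P : Constituent R M) :
    (Module.length R P.lower).toNat + P.length = (Module.length R P.upper).toNat := by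
  rw [length, ← ENat.toNat_add Module.length_ne_top Module.length_ne_top]
  refine congrArg ENat.toNat (Module.length_eq_add_of_exact (inclusion P.le)
    (P.lower.submoduleOf P.upper).mkQ (inclusion_injective _) (mkQ_surjective _) ?_).symm
  rw [LinearMap.exact_iff, ker_mkQ, range_inclusion]
  rfl

theorem NonsplitIn.length_lt {P Q : Constituent R M} (h : NonsplitIn P Q) :
    P.length < Q.length := by
  obtain ⟨hl, hu, hns⟩ := h
  have hP := P.toNat_length_lower_add_length
  have hQ := Q.toNat_length_lower_add_length
  have hmono := toNat_length_strictMono (R := R) (M := M)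
  have hl' := hmono.monotone hl
  have hu' := hmono.monotone hu
  by_cases hlower : Q.lower = P.lower
  · have hupper : P.upper ≠ Q.upper := fun hupper => hns
      ⟨Q.upper, Q.lower, sup_eq_left.2 Q.le, inf_eq_right.2 Q.le,
        hupper ▸ sup_eq_right.2 P.le, by rw [← hlower, inf_eq_left.2 Q.le]⟩
    have hlt := hmono (hu.lt_of_ne hupper)
    grind
  · have := hmono (hl.lt_of_ne hlower)
    grind

theorem Enclosed.virtEq_or_length_lt {P Q : Constituent R M} (h : Enclosed P Q) :
    VirtEq P Q ∨ P.length < Q.length := by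
  induction h with
  | refl => exact .inl (.refl _)
  | tail _ hstep ih =>
    rcases ih with ih | ih <;> rcases hstep with h | h
    · exact .inl (.trans _ _ _ ih h)
    · exact .inr (ih.length_eq ▸ h.length_lt)
    · exact .inr (VirtEq.length_eq h ▸ ih)
    · exact .inr (ih.trans h.length_lt)

theorem exists_enclosed_maximal {ι : Type*} {p : ι → Prop} (c : ι → Constituent R M)
    (hp : ∃ i, p i) : ∃ i, p i ∧ ∀ j, p j → Enclosed (c i) (c j) → VirtEq (c i) (c j) := by
  have hle (P : Constituent R M) : P.length ≤ (Module.length R (⊤ : Submodule R M)).toNat :=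
    calc P.length ≤ (Module.length R P.lower).toNat + P.length := Nat.le_add_left _ _
      _ = (Module.length R P.upper).toNat := P.toNat_length_lower_add_length
      _ ≤ _ := toNat_length_strictMono.monotone le_top
  have hbdd : BddAbove ((fun i => (c i).length) '' {i | p i}) :=
    ⟨_, Set.forall_mem_image.2 fun i _ => hle (c i)⟩
  obtain ⟨_, ⟨i, hi, rfl⟩, hmax⟩ := hbdd.exists_isGreatest_of_nonempty (Set.Nonempty.image _ hp)
  exact ⟨i, hi, fun j hj h => h.virtEq_or_length_lt.resolve_right
    (hmax (Set.mem_image_of_mem _ hj)).not_gt⟩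

end Constituent

end Length

section Enclosure

open Constituent

variable {R : Type u} [Ring R] {M : Type v} [AddCommGroup M] [Module R M]

theorem Indecomposable.eq_or_eq_of_quotient {X D C : Submodule R M}
    (h : Indecomposable R (M ⧸ X)) (hsup : D ⊔ C = ⊤) (hinf : D ⊓ C = X) : D = X ∨ C = X := by
  have hcomap {W : Submodule R M} (hW : X ≤ W) : (W.map X.mkQ).comap X.mkQ = W := by
    rw [comap_map_mkQ, sup_eq_right.2 hW]
  have hbot {W : Submodule R M} (hW : X ≤ W) (h : W.map X.mkQ = ⊥) : W = X := by
    rw [← hcomap hW, h, comap_bot, ker_mkQ]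
  have hD : X ≤ D := hinf ▸ inf_le_left
  have hC : X ≤ C := hinf ▸ inf_le_right
  refine (h.2 (D.map X.mkQ) (C.map X.mkQ) (.of_eq ?_ ?_)).imp (hbot hD) (hbot hC)
  · apply comap_injective_of_surjective X.mkQ_surjective
    rw [comap_inf, hcomap hD, hcomap hC, comap_bot, ker_mkQ, hinf]
  · rw [← Submodule.map_sup, hsup, Submodule.map_top, range_mkQ]

theorem Indecomposable.eq_bot_or_eq_bot_of_submodule {Y D C : Submodule R M}
    (h : Indecomposable R Y) (hsup : D ⊔ C = Y) (hinf : D ⊓ C = ⊥) : D = ⊥ ∨ C = ⊥ := by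
  have hD : D ≤ Y := hsup ▸ le_sup_left
  have hC : C ≤ Y := hsup ▸ le_sup_right
  have hbot {W : Submodule R M} (hW : W ≤ Y) (h : W.submoduleOf Y = ⊥) : W = ⊥ :=
    (disjoint_iff_comap_eq_bot.2 h).symm.eq_bot_of_le hW
  refine (h.2 (D.submoduleOf Y) (C.submoduleOf Y) (.of_eq ?_ ?_)).imp (hbot hD) (hbot hC)
  · rw [submoduleOf, submoduleOf, ← comap_inf, hinf, comap_bot, ker_subtype]
  · rw [← submoduleOf_sup_of_le hD hC, hsup, submoduleOf_self]

theorem enclosed_quot {N L X : Submodule R M} (hNL : N < L) (hLX : L ⊓ X = N)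
    (hind : Indecomposable R (M ⧸ X)) : Enclosed (Constituent.of N L hNL.le) (quot X) := by
  have hvirt : VirtEq (Constituent.of N L hNL.le) ⟨X, L ⊔ X, le_sup_right⟩ := by
    subst hLX
    exact .symm _ _ (.rel _ _ ⟨L, X, rfl, rfl⟩)
  refine (Relation.ReflTransGen.single (.inl hvirt)).trans ?_
  by_cases htop : L ⊔ X = ⊤
  · simp only [quot, htop]
    exact .refl
  refine .single (.inr ⟨le_rfl, le_top, ?_⟩)
  rintro ⟨D, C, hsup : D ⊔ C = ⊤, hinf : D ⊓ C = X, hD : X ⊔ D = L ⊔ X, -⟩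
  rw [sup_eq_right.2 (hinf ▸ inf_le_left)] at hD
  rcases hind.eq_or_eq_of_quotient hsup hinf with h | h
  · have hle : L ≤ X := sup_eq_right.1 (hD.symm.trans h)
    exact hNL.ne (by rw [← hLX, inf_eq_left.2 hle])
  · rw [h, sup_eq_left.2 (hinf ▸ inf_le_left)] at hsup
    exact htop (hD ▸ hsup)

theorem enclosed_sub {N L Y : Submodule R M} (hNL : N < L) (hYN : Y ⊔ N = L)
    (hind : Indecomposable R Y) : Enclosed (Constituent.of N L hNL.le) (sub Y) := by
  have hvirt : VirtEq (Constituent.of N L hNL.le) ⟨Y ⊓ N, Y, inf_le_left⟩ := by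
    subst hYN
    exact .rel _ _ ⟨Y, N, rfl, rfl⟩
  refine (Relation.ReflTransGen.single (.inl hvirt)).trans ?_
  by_cases hbot : Y ⊓ N = ⊥
  · simp only [sub, hbot]
    exact .refl
  refine .single (.inr ⟨bot_le, le_rfl, ?_⟩)
  rintro ⟨D, C, hsup : D ⊔ C = Y, hinf : D ⊓ C = ⊥, hD : Y ⊓ N ⊔ D = Y, hD' : Y ⊓ N ⊓ D = ⊥⟩
  rcases hind.eq_bot_or_eq_bot_of_submodule hsup hinf with h | h
  · have hle : Y ≤ N := by rwa [h, sup_bot_eq, inf_eq_left] at hD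
    exact hNL.ne (by rw [← hYN, sup_eq_right.2 hle])
  · rw [h, sup_bot_eq] at hsup
    rw [hsup, inf_eq_left.2 inf_le_left] at hD'
    exact hbot hD'

end Enclosure

section HullQuotient

variable {R : Type u} [Ring R] {M : Type v} [AddCommGroup M] [Module R M] {N K L X : Submodule R M}

theorem IsInjectiveHull.isUniform_of_injective {B : Type v} [AddCommGroup B] [Module R B]
    {I : Type w} [AddCommGroup I] [Module R I] {j : B →ₗ[R] I} (hj : IsInjectiveHull j)
    (hB : IsUniform R B) [Nontrivial M] (f : M →ₗ[R] I) (hf : Function.Injective f) :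
    IsUniform R M :=
  (IsEssential.isUniform hj.2.2 hj.2.1 hB).of_injective f hf

theorem mapQ_injective {M' : Type w} [AddCommGroup M'] [Module R M'] {p : Submodule R M}
    {q : Submodule R M'} {f : M →ₗ[R] M'} (hpq : p ≤ q.comap f) (hqp : q.comap f ≤ p) :
    Function.Injective (mapQ p q f hpq) := by
  refine LinearMap.ker_eq_bot.1 (ker_liftQ_eq_bot _ _ _ ?_)
  rwa [LinearMap.ker_comp, ker_mkQ]

theorem nontrivial_subquotient (hNK : N < K) : Nontrivial (K ⧸ N.submoduleOf K) :=
  Quotient.nontrivial_iff.2 (submoduleOf_eq_top.not.2 hNK.not_ge)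

theorem IsUniform.subquotient_of_le (hNK : N < K) (hKL : K ≤ L)
    (h : IsUniform R (L ⧸ N.submoduleOf L)) : IsUniform R (K ⧸ N.submoduleOf K) :=
  have := nontrivial_subquotient hNK
  h.of_injective (mapQ _ _ (inclusion hKL) le_rfl) (mapQ_injective _ le_rfl)

theorem exists_extension_of_inf_eq {I : Type w} [AddCommGroup I] [Module R I] [Small.{w} R]
    [Module.Injective R I] {T : Submodule R M} (hNT : N ≤ T) (hKT : K ⊓ T = N)
    (j : (K ⧸ N.submoduleOf K) →ₗ[R] I) :
    ∃ f : M →ₗ[R] I, T ≤ LinearMap.ker f ∧ ∀ k : K, f k = j ((N.submoduleOf K).mkQ k) := by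
  let i := mapQ (N.submoduleOf K) T K.subtype (comap_mono hNT)
  have hi : Function.Injective i := mapQ_injective _ fun k hk => hKT.le ⟨k.2, hk⟩
  obtain ⟨f, hf⟩ := Module.Injective.extension_property R I _ _ i hi j
  refine ⟨f ∘ₗ T.mkQ, ?_, fun k => LinearMap.congr_fun hf (mkQ _ k)⟩
  exact T.ker_mkQ.ge.trans (LinearMap.ker_le_ker_comp _ _)

theorem IsUniform.inf_ker_eq (h : IsUniform R (L ⧸ N.submoduleOf L)) (hNK : N < K) (hKL : K ≤ L)
    {I : Type*} [AddCommGroup I] [Module R I] {j : (K ⧸ N.submoduleOf K) →ₗ[R] I}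
    (hj : Function.Injective j) {f : M →ₗ[R] I} (hfN : N ≤ LinearMap.ker f)
    (hfj : ∀ k : K, f k = j ((N.submoduleOf K).mkQ k)) : L ⊓ LinearMap.ker f = N := by
  have := nontrivial_subquotient hNK
  let i := mapQ (N.submoduleOf K) (N.submoduleOf L) (inclusion hKL) le_rfl
  let f' : (L ⧸ N.submoduleOf L) →ₗ[R] I :=
    liftQ (N.submoduleOf L) (f ∘ₗ L.subtype) fun x hx => hfN hx
  have hinj : Function.Injective i := mapQ_injective _ le_rfl
  have hi : LinearMap.range i ≠ ⊥ :=
    fun h0 => LinearMap.ne_zero_of_injective hinj (LinearMap.range_eq_bot.1 h0)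
  have hf'i : f' ∘ₗ i = j := linearMap_qext _ (LinearMap.ext hfj)
  have hf' : Function.Injective f' := (h.isEssential hi).injective_of_comp (hf'i.symm ▸ hj)
  refine le_antisymm (fun x ⟨hxL, hx⟩ => ?_) (le_inf (hNK.le.trans hKL) hfN)
  have hmk : (N.submoduleOf L).mkQ ⟨x, hxL⟩ = 0 := (map_eq_zero_iff f' hf').1 hx
  exact (Quotient.mk_eq_zero (N.submoduleOf L)).1 hmk

theorem IsHullQuotient.isUniform {hNL : N ≤ L} (h : IsHullQuotient N K L hNL X)
    (hNK : N < K) (hKL : K ≤ L) (hunif : IsUniform R (L ⧸ N.submoduleOf L)) :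
    IsUniform R (M ⧸ X) := by
  obtain ⟨-, hLX, I, _, _, j, f, hj, hf, -⟩ := h
  have : Nontrivial (M ⧸ X) := Quotient.nontrivial_iff.2 fun hX =>
    (hNK.trans_le hKL).ne (by rw [← hLX, hX, inf_top_eq])
  exact hj.isUniform_of_injective (hunif.subquotient_of_le hNK hKL) f hf

theorem exists_isHullQuotient [IsArtinian R M] [IsNoetherian R M] (hNK : N < K) (hKL : K ≤ L)
    (hunif : IsUniform R (L ⧸ N.submoduleOf L)) :
    ∃ X, IsHullQuotient N K L (hNK.le.trans hKL) X := by
  have hNL : N < L := hNK.trans_le hKL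
  obtain ⟨i, hdepth, hi, hi'⟩ := exists_radDepth (E := Constituent.of N L hNL.le) hNL
  have hKT : K ⊓ (N ⊔ radPow R M (i + 1)) = N := by
    refine le_antisymm ((inf_le_inf_right _ hKL).trans ?_) (le_inf hNK.le le_sup_left)
    rw [inf_comm, sup_inf_assoc_of_le _ hNL.le, inf_comm]
    exact sup_le le_rfl hi
  obtain ⟨I, _, _, j, hj⟩ := exists_isInjectiveHull (R := R) (K ⧸ N.submoduleOf K)
  have := hj.1
  obtain ⟨f, hTf, hfj⟩ := exists_extension_of_inf_eq le_sup_left hKT j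
  have hLf : L ⊓ LinearMap.ker f = N :=
    hunif.inf_ker_eq hNK hKL hj.2.1 (le_sup_left.trans hTf) hfj
  have hloewy : HasLoewyLength R (M ⧸ LinearMap.ker f) (i + 1) := by
    refine hasLoewyLength_succ ((radPow_quotient_eq_bot_iff _ _).2 (le_sup_right.trans hTf))
      (mt (radPow_quotient_eq_bot_iff _ _).1 fun hle => hi' ((inf_le_inf_left L hle).trans hLf.le))
  let f' := liftQ (LinearMap.ker f) f le_rfl
  have hf' : Function.Injective f' := LinearMap.ker_eq_bot.1 (ker_liftQ_eq_bot' _ f rfl)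
  have : Nontrivial (M ⧸ LinearMap.ker f) := Quotient.nontrivial_iff.2 fun htop =>
    hNL.ne (by rw [← hLf, htop, inf_top_eq])
  have hind : Indecomposable R (M ⧸ LinearMap.ker f) :=
    (hj.isUniform_of_injective (hunif.subquotient_of_le hNK hKL) f' hf').indecomposable
  exact ⟨LinearMap.ker f, ⟨enclosed_quot hNL hLf hind, i + 1, hdepth, hloewy⟩, hLf,
    I, _, _, j, f', hj, hf', hfj⟩

end HullQuotient

section CoverSubmodule

variable {R : Type u} [Ring R] {M : Type v} [AddCommGroup M] [Module R M] {N K L Y : Submodule R M}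

theorem IsProjectiveCover.isHollow_of_surjective {A : Type v} [AddCommGroup A] [Module R A]
    {P : Type w} [AddCommGroup P] [Module R P] {p : P →ₗ[R] A} (hp : IsProjectiveCover p)
    (hA : IsHollow R A) [Nontrivial M] (g : P →ₗ[R] M) (hg : Function.Surjective g) :
    IsHollow R M :=
  (IsSuperfluous.isHollow hp.2.2 hp.2.1 hA).of_surjective g hg

theorem IsHollow.subquotient_of_ge (hNK : N ≤ K) (hKL : K < L)
    (h : IsHollow R (L ⧸ N.submoduleOf L)) : IsHollow R (L ⧸ K.submoduleOf L) :=
  have := nontrivial_subquotient hKL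
  h.of_surjective _ (factor_surjective (comap_mono hNK))

theorem exists_lift_of_sup_eq {P : Type w} [AddCommGroup P] [Module R P] [Module.Projective R P]
    {T : Submodule R M} (hTL : T ≤ L) (hKL : K ≤ L) (hTK : T ⊔ K = L)
    (p : P →ₗ[R] (L ⧸ K.submoduleOf L)) :
    ∃ g : P →ₗ[R] L, LinearMap.range g ≤ T.submoduleOf L ∧ (K.submoduleOf L).mkQ ∘ₗ g = p := by
  have hsurj : Function.Surjective ((K.submoduleOf L).mkQ ∘ₗ inclusion hTL) := by
    rw [← LinearMap.range_eq_top, LinearMap.range_comp, range_inclusion, map_mkQ_eq_top, sup_comm]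
    exact (submoduleOf_sup_of_le hTL hKL).symm.trans (hTK ▸ submoduleOf_self L)
  obtain ⟨g, hg⟩ := Module.projective_lifting_property _ p hsurj
  exact ⟨inclusion hTL ∘ₗ g, (LinearMap.range_comp_le_range _ _).trans (range_inclusion _ _ hTL).le,
    hg⟩

theorem IsHollow.map_range_sup_eq (h : IsHollow R (L ⧸ N.submoduleOf L)) (hNK : N ≤ K) (hKL : K < L)
    {P : Type*} [AddCommGroup P] [Module R P] {p : P →ₗ[R] (L ⧸ K.submoduleOf L)}
    (hp : Function.Surjective p) {g : P →ₗ[R] L} (hgp : (K.submoduleOf L).mkQ ∘ₗ g = p) :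
    (LinearMap.range g).map L.subtype ⊔ N = L := by
  have := nontrivial_subquotient hKL
  let q : (L ⧸ N.submoduleOf L) →ₗ[R] (L ⧸ K.submoduleOf L) := factor (comap_mono hNK)
  have hq : Function.Surjective q := factor_surjective _
  have hker : LinearMap.ker q ≠ ⊤ :=
    fun h0 => LinearMap.ne_zero_of_surjective hq (LinearMap.ker_eq_top.1 h0)
  have hqg : q ∘ₗ (N.submoduleOf L).mkQ ∘ₗ g = p := hgp
  have hsurj : Function.Surjective ((N.submoduleOf L).mkQ ∘ₗ g) :=
    (h.isSuperfluous hker).surjective_of_comp (hqg.symm ▸ hp)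
  have htop : LinearMap.range g ⊔ N.submoduleOf L = ⊤ := by
    rw [sup_comm, ← map_mkQ_eq_top, ← LinearMap.range_comp, LinearMap.range_eq_top.2 hsurj]
  have hmap := congrArg (Submodule.map L.subtype) htop
  rwa [Submodule.map_sup, submoduleOf, map_comap_subtype, map_subtype_top,
    inf_eq_right.2 (hNK.trans hKL.le)] at hmap

theorem IsCoverSubmodule.isHollow {hNL : N ≤ L} (h : IsCoverSubmodule N K L hNL Y) (hNK : N ≤ K)
    (hKL : K < L) (hhollow : IsHollow R (L ⧸ N.submoduleOf L)) : IsHollow R Y := by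
  obtain ⟨-, hYN, P, _, _, p, g, hYL, hp, hg, -⟩ := h
  have : Nontrivial Y := nontrivial_iff_ne_bot.2 fun hY =>
    (hNK.trans_lt hKL).ne (by rw [← hYN, hY, bot_sup_eq])
  exact hp.isHollow_of_surjective (hhollow.subquotient_of_ge hNK hKL) g hg

theorem exists_isCoverSubmodule [IsArtinian R M] [IsNoetherian R M] (hNK : N ≤ K) (hKL : K < L)
    (hhollow : IsHollow R (L ⧸ N.submoduleOf L))
    (hcover : HasProjectiveCover R (L ⧸ K.submoduleOf L)) :
    ∃ Y, IsCoverSubmodule N K L (hNK.trans hKL.le) Y := by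
  have hNL : N < L := hNK.trans_lt hKL
  obtain ⟨i, hdepth, hi, hi'⟩ := exists_socDepth (E := Constituent.of N L hNL.le) hNL
  have hTK : L ⊓ socPow R M (i + 1) ⊔ K = L :=
    le_antisymm (sup_le inf_le_left hKL.le)
      (hi.ge.trans (sup_le (hNK.trans le_sup_right) le_sup_left))
  obtain ⟨P, _, _, p, hp⟩ := hcover
  have := hp.1
  obtain ⟨g, hgT, hgp⟩ := exists_lift_of_sup_eq inf_le_left hKL.le hTK p
  let Y := (LinearMap.range g).map L.subtype
  have hYL : Y ≤ L := map_subtype_le _ _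
  have hYN : Y ⊔ N = L := hhollow.map_range_sup_eq hNK hKL hp.2.1 hgp
  have hloewy : HasLoewyLength R Y (i + 1) := by
    have hYT : Y ≤ L ⊓ socPow R M (i + 1) := map_le_iff_le_comap.2 hgT
    refine hasLoewyLength_succ ((radPow_submodule_eq_bot_iff _ _).2 (hYT.trans inf_le_right))
      (mt (radPow_submodule_eq_bot_iff _ _).1 fun hle => ?_)
    refine hi' (le_antisymm (sup_le hNL.le inf_le_left) (hYN.ge.trans ?_))
    exact sup_le ((le_inf hYL hle).trans le_sup_right) le_sup_left
  let g' : P →ₗ[R] Y := L.subtype.submoduleMap (LinearMap.range g) ∘ₗ g.rangeRestrict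
  have hg' : Function.Surjective g' :=
    (L.subtype.submoduleMap_surjective _).comp g.surjective_rangeRestrict
  have : Nontrivial Y := nontrivial_iff_ne_bot.2 fun hY =>
    hNL.ne (by rw [← hYN, hY, bot_sup_eq])
  have hind : Indecomposable R Y :=
    (hp.isHollow_of_surjective (hhollow.subquotient_of_ge hNK hKL) g' hg').indecomposable
  exact ⟨Y, ⟨enclosed_sub hNL hYN hind, i + 1, hdepth, hloewy⟩, hYN,
    P, _, _, p, g', hYL, hp, hg', LinearMap.congr_fun hgp⟩

end CoverSubmodule

end VirtualExt

open VirtualExt Constituent in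
theorem mainTheorem5_general {R : Type*} [Ring R] {M : Type*} [AddCommGroup M] [Module R M]
    [IsArtinian R M] [IsNoetherian R M] (N K L : Submodule R M) (hNK : N < K) (hKL : K < L) :
    (IsUniform R (L ⧸ N.submoduleOf L) →
      (∃ X : Submodule R M, IsHullQuotient N K L (hNK.trans hKL).le X ∧
        ∀ X' : Submodule R M, IsHullQuotient N K L (hNK.trans hKL).le X' →
          Enclosed (.quot X) (.quot X') → VirtEq (.quot X) (.quot X')) ∧
      ∀ X : Submodule R M, IsHullQuotient N K L (hNK.trans hKL).le X →
        IsUniform R (M ⧸ X)) ∧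
    (IsHollow R (L ⧸ N.submoduleOf L) →
      (IsArtinianRing R ∨ HasProjectiveCover R (L ⧸ K.submoduleOf L)) →
      (∃ Y : Submodule R M, IsCoverSubmodule N K L (hNK.trans hKL).le Y ∧
        ∀ Y' : Submodule R M, IsCoverSubmodule N K L (hNK.trans hKL).le Y' →
          Enclosed (.sub Y) (.sub Y') → VirtEq (.sub Y) (.sub Y')) ∧
      ∀ Y : Submodule R M, IsCoverSubmodule N K L (hNK.trans hKL).le Y → IsHollow R Y) := by
  refine ⟨fun hunif => ⟨exists_enclosed_maximal _ (exists_isHullQuotient hNK hKL.le hunif),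
    fun X hX => hX.isUniform hNK hKL.le hunif⟩, fun hhollow hcover =>
    ⟨exists_enclosed_maximal _ (exists_isCoverSubmodule hNK.le hKL hhollow ?_),
      fun Y hY => hY.isHollow hNK.le hKL hhollow⟩⟩
  rcases hcover with hR | hcover
  · exact hasProjectiveCover_of_isArtinianRing _
  · exact hcover

theorem mainTheorem5 {R : Type*} [Ring R] {M : Type*} [AddCommGroup M] [Module R M]
    [IsArtinian R M] [IsNoetherian R M]
    (N K L : Submodule R M) (hNK : N < K) (hKL : K < L)
    (hlen : Module.length R (↥L ⧸ N.submoduleOf L) = 2)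
    (hind : VirtualExt.Indecomposable R (↥L ⧸ N.submoduleOf L)) :
    ((∃ X : Submodule R M, VirtualExt.IsHullQuotient N K L (hNK.trans hKL).le X ∧
        ∀ X' : Submodule R M, VirtualExt.IsHullQuotient N K L (hNK.trans hKL).le X' →
          VirtualExt.Constituent.Enclosed (.quot X) (.quot X') →
            VirtualExt.Constituent.VirtEq (.quot X) (.quot X')) ∧
      ∀ X : Submodule R M, VirtualExt.IsHullQuotient N K L (hNK.trans hKL).le X →
        VirtualExt.Indecomposable R (M ⧸ X)) ∧
    ((IsArtinianRing R ∨ VirtualExt.HasProjectiveCover R (↥L ⧸ K.submoduleOf L)) →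
      (∃ Y : Submodule R M, VirtualExt.IsCoverSubmodule N K L (hNK.trans hKL).le Y ∧
        ∀ Y' : Submodule R M, VirtualExt.IsCoverSubmodule N K L (hNK.trans hKL).le Y' →
          VirtualExt.Constituent.Enclosed (.sub Y) (.sub Y') →
            VirtualExt.Constituent.VirtEq (.sub Y) (.sub Y')) ∧
      ∀ Y : Submodule R M, VirtualExt.IsCoverSubmodule N K L (hNK.trans hKL).le Y →
        VirtualExt.Indecomposable R ↥Y) := by
  obtain ⟨hhull, hcover⟩ := mainTheorem5_general N K L hNK hKL
  exact ⟨(hhull (hind.isUniform_of_length_eq_two hlen)).imp_right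
      fun h X hX => (h X hX).indecomposable,
    fun hA => (hcover (hind.isHollow_of_length_eq_two hlen) hA).imp_right
      fun h Y hY => (h Y hY).indecomposable⟩
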